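/- Let $\mathbb K$ be a field. A tangle diagram $T$ in a disc consists of arcs (with end points on the boundary circle) and circles. An arc of $T$ is called pure if, at every point of it, each of the two sides of the arc can be connected to the boundary of the disc by a path that avoids the diagram; $T$ is simple if all its arcs are pure. For an oriented tangle diagram $T$ with $n_+$ right-handed (positive) and $n_-$ left-handed (negative) crossings, let $H^{k,q}(T)$ denote Khovanov homology over $\mathbb K$ in homological degree $k$ and quantum degree $q$: the homology of the complex of the cube of resolutions of $T$, where a smoothed diagram is sent to the tensor product of one copy of $V=\langle v_+,v_-\rangle$ ($\deg v_\pm=\pm1$) for every circle and one copy of $W=\langle w\rangle$ ($\deg w=-1$) for every arc; saddles act on circles by $v_+v_+=v_+$, $v_+v_-=v_-v_+=v_-$, $v_-v_-=0$ and $v_+\mapsto v_+\otimes v_-+v_-\otimes v_+$, $v_-\mapsto v_-\otimes v_-$, a circle merging into an arc acts by $v_+\otimes w\mapsto w$, $v_-\otimes w\mapsto 0$, a circle splitting off an arc acts by $w\mapsto v_-\otimes w$, and a saddle between two arcs that yields two arcs acts by $0$. A state with $r$ $1$-smoothings has homological degree $k=r-n_-$, and an element of degree $\theta$ in it has quantum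 degree $q=k+n_+-n_-+\theta$. Theorem. Let $T$ be an oriented simple tangle diagram consisting of exactly $N$ arcs and no circles, with $n_+$ right-handed and $n_-$ left-handed crossings. Then $$\dim_{\mathbb K}\bigoplus_{k,q}H^{k,q}(T)=2^{n_++n_-},$$ and for every commutative ring $R$ (in particular $R=\mathbb Z$ and $R=\mathbb K$) and all $k,q\in\mathbb Z$, the image of $\dim_{\mathbb K}H^{k,q}(T)$ in $R$ is the coefficient of $(k,q)$ in the expansion of $$(0,-1)^{N-n_+-n_-}\,\big[(0,0)+(1,1)\big]^{n_+}\,\big[(-1,-3)+(0,-2)\big]^{n_-}$$ in the group algebra $R[\mathbb Z\times\mathbb Z]$, where $(k,q)$ denotes the basis element of $R[\mathbb Z\times\mathbb Z]$ belonging to that group element. For $R=\mathbb Z$ this says that the bidegrees of the generators, with multiplicity, are the terms of the expansion. -/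

import Mathlib

/-!
Tangle diagrams in a disc, simple tangles, and the Khovanov homology of tangle diagrams.

A tangle diagram is drawn in a rectangle (a disc) in general position with respect to the height
function: it is cut by finitely many horizontal level lines into layers, and each layer holds
exactly one event: a minimum (`cup`), a maximum (`cap`) or a crossing of two neighbouring strands,
all other strands running monotonically through the layer.  Every tangle diagram in a disc is of
this form up to an isotopy of the disc.  The end points of the tangle lie on the bottom and on the
top side of the rectangle.  Arcs, closed components (circles), self-crossings and nested or split
pieces are all allowed.
-/

namespace KhTangle

/-- The event in one layer, read upwards.  Strands at a level line are numbered `0, 1, 2, …` from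
left to right.
* `cup i` : a local minimum; it creates the two strands `i`, `i + 1` above it.
* `cap i` : a local maximum; it closes off the two strands `i`, `i + 1` below it.
* `cross i o` : the strands `i` and `i + 1` cross; the strand which runs from bottom left
  to top right passes over the other one if `o = true`, and under it if `o = false`. -/
inductive Layer where
  | cup (i : ℕ)
  | cap (i : ℕ)
  | cross (i : ℕ) (o : Bool)

namespace Layer

/-- The layer can sit between a level with `w` strands (below) and one with `w'` strands (above). -/
def Fits : Layer → ℕ → ℕ → Prop
  | cup i, w, w' => i ≤ w ∧ w' = w + 2
  | cap i, w, w' => i ≤ w' ∧ w = w' + 2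
  | cross i _, w, w' => i + 1 < w ∧ w' = w

/-- Is the event a crossing? -/
def isCross : Layer → Bool
  | cup _ => false
  | cap _ => false
  | cross _ _ => true

/-- The position `i` of the event. -/
def pos : Layer → ℕ
  | cup i => i
  | cap i => i
  | cross i _ => i

/-- For a crossing: does the strand from bottom left to top right pass over? -/
def slashOver : Layer → Bool
  | cup _ => false
  | cap _ => false
  | cross _ o => o

end Layer

/-- What is drawn in place of a crossing: the crossing itself (`pass`), the planar smoothing
by two vertical strands `)(` (`vert`), or the one by a cap below a cup (`horiz`). -/
inductive Local where
  | pass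
  | vert
  | horiz

namespace Layer

/-- With `m` in place of a crossing, strand `a` at the lower level of the layer is connected,
inside the layer, to strand `b` at the upper level. -/
def Through : Layer → Local → ℕ → ℕ → Prop
  | cup i, _, a, b => b = if a < i then a else a + 2
  | cap i, _, a, b => a = if b < i then b else b + 2
  | cross i _, Local.pass, a, b => b = Equiv.swap i (i + 1) a
  | cross _ _, Local.vert, a, b => b = a
  | cross i _, Local.horiz, a, b => b = a ∧ a ≠ i ∧ a ≠ i + 1

/-- With `m` in place of a crossing, the strands `a`, `b` at the lower level of the layer
are connected by a cap inside the layer. -/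
def Capped : Layer → Local → ℕ → ℕ → Prop
  | cap i, _, a, b => a = i ∧ b = i + 1
  | cross i _, Local.horiz, a, b => a = i ∧ b = i + 1
  | _, _, _, _ => False

/-- With `m` in place of a crossing, the strands `a`, `b` at the upper level of the layer
are connected by a cup inside the layer. -/
def Cupped : Layer → Local → ℕ → ℕ → Prop
  | cup i, _, a, b => a = i ∧ b = i + 1
  | cross i _, Local.horiz, a, b => a = i ∧ b = i + 1
  | _, _, _, _ => False

/-- Inside the layer, the gap `g` of the lower level and the gap `h` of the upper level can be
joined by a path that avoids the diagram.  Gap `g` is the part of a level line between the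
strands `g - 1` and `g` (gap `0` is left of all strands, the last gap is right of all strands). -/
def GapThrough : Layer → ℕ → ℕ → Prop
  | cup i, g, h => (g ≤ i ∧ h = g) ∨ (i ≤ g ∧ h = g + 2)
  | cap i, g, h => (h ≤ i ∧ g = h) ∨ (i ≤ h ∧ g = h + 2)
  | cross i _, g, h => g ≠ i + 1 ∧ h = g

end Layer

/-- A tangle diagram: level lines `0, …, length`, with `width k` strands meeting the level line
`k`, and one layer between each two consecutive level lines. -/
structure TangleDiagram where
  length : ℕ
  width : Fin (length + 1) → ℕ
  layer : Fin length → Layer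
  fits : ∀ k, (layer k).Fits (width k.castSucc) (width k.succ)

namespace TangleDiagram

variable (D : TangleDiagram)

/-- The intersection points of the diagram with the level lines: `(level, strand)`. -/
abbrev Point : Type := Σ k : Fin (D.length + 1), Fin (D.width k)

/-- The diagram in which `R k` is drawn in place of the crossing in layer `k` (`R k` plays no role
if layer `k` is not a crossing), as a graph on the points: neighbouring points on
a strand are adjacent. -/
def graph (R : Fin D.length → Local) : SimpleGraph D.Point :=
  SimpleGraph.fromRel fun p q => ∃ k : Fin D.length,
    (p.1 = k.castSucc ∧ q.1 = k.succ ∧ (D.layer k).Through (R k) p.2 q.2) ∨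
    (p.1 = k.castSucc ∧ q.1 = k.castSucc ∧ (D.layer k).Capped (R k) p.2 q.2) ∨
    (p.1 = k.succ ∧ q.1 = k.succ ∧ (D.layer k).Cupped (R k) p.2 q.2)

/-- The components (arcs and circles) of the diagram in which `R k` is drawn in
place of the crossing in layer `k`. -/
abbrev Comp (R : Fin D.length → Local) : Type := (D.graph R).ConnectedComponent

/-- The points on the boundary of the disc, i.e. the end points of the tangle. -/
def IsEndpoint (p : D.Point) : Prop := p.1 = 0 ∨ p.1 = Fin.last D.length

/-- A component is an arc if it reaches the boundary of the disc; otherwise it is a circle. -/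
def IsArc {R : Fin D.length → Local} (X : D.Comp R) : Prop :=
  ∃ p : D.Point, D.IsEndpoint p ∧ (D.graph R).connectedComponentMk p = X

/-- The components of the tangle itself: strands run straight through the crossings. -/
abbrev Component : Type := D.Comp fun _ => Local.pass

/-- The tangle consists of `N` arcs (and has no circles). -/
def ConsistsOfArcs (N : ℕ) : Prop :=
  (∀ X : D.Component, D.IsArc X) ∧ Nat.card D.Component = N

/-! ### Regions and simple tangles -/

/-- The gaps in the level lines: `(level, gap)`. -/
abbrev Gap : Type := Σ k : Fin (D.length + 1), Fin (D.width k + 1)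

/-- Two gaps are adjacent if a path inside one layer that avoids the diagram joins them.  The
connected components of this graph are the regions of the complement of the diagram. -/
def gapGraph : SimpleGraph D.Gap :=
  SimpleGraph.fromRel fun g h => ∃ k : Fin D.length,
    g.1 = k.castSucc ∧ h.1 = k.succ ∧ (D.layer k).GapThrough g.2 h.2

/-- The gap meets the boundary of the disc: it lies on the bottom or top side, or it
reaches the left or the right side of the rectangle. -/
def Gap.OnBoundary {D : TangleDiagram} (g : D.Gap) : Prop :=
  g.1 = 0 ∨ g.1 = Fin.last D.length ∨ (g.2 : ℕ) = 0 ∨ (g.2 : ℕ) = D.width g.1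

/-- The gap can be connected to the boundary of the disc by a path that avoids the diagram. -/
def Gap.ReachesBoundary {D : TangleDiagram} (g : D.Gap) : Prop :=
  ∃ h : D.Gap, h.OnBoundary ∧ D.gapGraph.Reachable g h

/-- The gap directly to the left of a point. -/
def leftGap (p : D.Point) : D.Gap := ⟨p.1, p.2.castSucc⟩

/-- The gap directly to the right of a point. -/
def rightGap (p : D.Point) : D.Gap := ⟨p.1, p.2.succ⟩

/-- A component is pure if at every point of it, each of its two sides can be connected to the
boundary of the disc by a path that avoids the diagram. -/
def IsPure (X : D.Component) : Prop :=
  ∀ p : D.Point, (D.graph fun _ => Local.pass).connectedComponentMk p = X →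
    (D.leftGap p).ReachesBoundary ∧ (D.rightGap p).ReachesBoundary

/-- A tangle is simple if all its arcs are pure. -/
def IsSimple : Prop := ∀ X : D.Component, D.IsArc X → D.IsPure X

/-! ### Crossings, orientations, signs -/

/-- The crossings of the diagram, ordered by height. -/
abbrev Crossing : Type := {k : Fin D.length // (D.layer k).isCross = true}

theorem fits_cross (c : D.Crossing) :
    (D.layer c.1).pos + 1 < D.width c.1.castSucc ∧ D.width c.1.succ = D.width c.1.castSucc := by
  have h := D.fits c.1
  have hc := c.2
  revert h hc
  cases D.layer c.1 <;> simp [Layer.Fits, Layer.isCross, Layer.pos]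

/-- The bottom left corner of a crossing. -/
def botLeft (c : D.Crossing) : D.Point :=
  ⟨c.1.castSucc, ⟨(D.layer c.1).pos, Nat.lt_of_succ_lt (D.fits_cross c).1⟩⟩

/-- The bottom right corner of a crossing. -/
def botRight (c : D.Crossing) : D.Point :=
  ⟨c.1.castSucc, ⟨(D.layer c.1).pos + 1, (D.fits_cross c).1⟩⟩

/-- The top right corner of a crossing. -/
def topRight (c : D.Crossing) : D.Point :=
  ⟨c.1.succ, ⟨(D.layer c.1).pos + 1, (D.fits_cross c).2 ▸ (D.fits_cross c).1⟩⟩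

/-- An orientation of the tangle: at every point, its strand is directed upwards (`true`) or
downwards (`false`), coherently along each component. -/
structure Orientation where
  up : D.Point → Bool
  through : ∀ (k : Fin D.length) (p q : D.Point), p.1 = k.castSucc → q.1 = k.succ →
    (D.layer k).Through Local.pass p.2 q.2 → up p = up q
  capped : ∀ (k : Fin D.length) (p q : D.Point), p.1 = k.castSucc → q.1 = k.castSucc →
    (D.layer k).Capped Local.pass p.2 q.2 → up p ≠ up q
  cupped : ∀ (k : Fin D.length) (p q : D.Point), p.1 = k.succ → q.1 = k.succ →
    (D.layer k).Cupped Local.pass p.2 q.2 → up p ≠ up q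

variable {D}

/-- A crossing is right-handed (positive) if, with both strands directed upwards, the over strand
runs from bottom left to top right; reversing one of the strands changes the handedness. -/
def Orientation.IsRightHanded (o : D.Orientation) (c : D.Crossing) : Prop :=
  (D.layer c.1).slashOver = true ↔ o.up (D.botLeft c) = o.up (D.botRight c)

/-- The number `n₊` of right-handed crossings. -/
noncomputable def Orientation.nPos (o : D.Orientation) : ℕ :=
  Nat.card {c : D.Crossing // o.IsRightHanded c}

/-- The number `n₋` of left-handed crossings. -/
noncomputable def Orientation.nNeg (o : D.Orientation) : ℕ :=
  Nat.card {c : D.Crossing // ¬ o.IsRightHanded c}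

variable (D)

/-! ### The Khovanov complex

A state `s` of the cube of resolutions is the set of the crossings that get the `1`-smoothing.  To a
circle of the smoothed diagram we attach `V` with basis `v₊` (degree `1`) and `v₋` (degree `-1`), to
an arc the one-dimensional space `W` with basis `w` (degree `-1`), and to the state the tensor
product over all components.  Its standard basis consists of the labellings of the components by
signs, with `true` for `v₊`, and `false` for `v₋` on circles and for `w` on arcs. -/

/-- The vertices of the cube of resolutions. -/
abbrev State : Type := Finset D.Crossing

/-- The smoothing of all crossings according to a state.  The `0`-smoothing of a crossing joins the
two regions swept out by the over strand when it is turned counterclockwise towards the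
under strand: it is vertical if the strand from bottom left to top right passes over, and
horizontal otherwise.  The `1`-smoothing is the other one. -/
def resolution (s : D.State) (k : Fin D.length) : Local :=
  if (D.layer k).slashOver = decide (∃ c ∈ s, c.1 = k) then Local.horiz else Local.vert

/-- The components (arcs and circles) of the smoothed diagram of a state. -/
abbrev StateComp (s : D.State) : Type := D.Comp (D.resolution s)

/-- The standard basis of the Khovanov complex: a state with a sign on every
component of its smoothed diagram, where arcs carry the sign `-`. -/
structure Gen where
  state : D.State
  sign : D.StateComp state → Bool
  arc : ∀ X, D.IsArc X → sign X = false

instance finiteGen : Finite D.Gen := by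
  have hinj : Function.Injective
      (fun S : D.Gen => (⟨S.state, S.sign⟩ : Σ s : D.State, (D.StateComp s → Bool))) := by
    rintro ⟨s, e, h⟩ ⟨s', e', h'⟩ H
    obtain ⟨rfl, H⟩ := Sigma.mk.inj H
    obtain rfl := eq_of_heq H
    rfl
  have (s : D.State) : Finite (D.StateComp s) :=
    Finite.of_surjective _ Quot.mk_surjective
  exact Finite.of_injective _ hinj

variable {D}

/-- The component of the smoothed diagram that passes through a point. -/
def Gen.comp (S : D.Gen) (p : D.Point) : D.StateComp S.state :=
  (D.graph (D.resolution S.state)).connectedComponentMk p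

/-- The degree `θ`: the number of `+` signs minus the number of `-` signs. -/
noncomputable def Gen.theta (S : D.Gen) : ℤ :=
  (Nat.card {X // S.sign X = true} : ℤ) - Nat.card {X // S.sign X = false}

/-- Homological degree `k = r - n₋`, where `r` is the number of `1`-smoothings. -/
noncomputable def Gen.hdeg (o : D.Orientation) (S : D.Gen) : ℤ :=
  (S.state.card : ℤ) - o.nNeg

/-- Quantum degree `k + n₊ - n₋ + θ`. -/
noncomputable def Gen.qdeg (o : D.Orientation) (S : D.Gen) : ℤ :=
  S.hdeg o + o.nPos - o.nNeg + S.theta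

/-- Structure constants of the multiplication `V ⊗ V → V`:
`v₊v₊ = v₊`, `v₊v₋ = v₋v₊ = v₋`, `v₋v₋ = 0`.  Restricted to the sign `-` on arcs they also give
`V ⊗ W → W`: `v₊ ⊗ w ↦ w`, `v₋ ⊗ w ↦ 0`. -/
def mulCoeff : Bool → Bool → Bool → ℤ
  | true, true, true => 1
  | true, false, false => 1
  | false, true, false => 1
  | _, _, _ => 0

/-- Structure constants of the comultiplication `V → V ⊗ V`:
`v₊ ↦ v₊ ⊗ v₋ + v₋ ⊗ v₊`, `v₋ ↦ v₋ ⊗ v₋`.  Restricted to the sign `-` on arcs they also give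
`W → V ⊗ W`: `w ↦ v₋ ⊗ w`. -/
def comulCoeff : Bool → Bool → Bool → ℤ
  | true, true, false => 1
  | true, false, true => 1
  | false, false, false => 1
  | _, _, _ => 0

open Classical in
/-- The matrix entry, from `S` to `T`, of the map of the saddle at the crossing `c`; here the state
of `T` is that of `S` with `c` changed from `0` to `1`.  The two local strands of either smoothing
of `c` are the one at the bottom left corner and the one at the top right corner.  Signs of the
components away from `c` are kept.  At `c`, two components are merged by the multiplication,
a component is split by the comultiplication, and two arcs that are turned into two
arcs give the zero map `W ⊗ W → W ⊗ W`. -/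
noncomputable def saddleCoeff (c : D.Crossing) (S T : D.Gen) : ℤ :=
  let p := D.botLeft c
  let q := D.topRight c
  if ∀ x, S.comp x ≠ S.comp p → S.comp x ≠ S.comp q → T.sign (T.comp x) = S.sign (S.comp x) then
    if S.comp p ≠ S.comp q ∧ T.comp p = T.comp q then
      mulCoeff (S.sign (S.comp p)) (S.sign (S.comp q)) (T.sign (T.comp p))
    else if S.comp p = S.comp q ∧ T.comp p ≠ T.comp q then
      comulCoeff (S.sign (S.comp p)) (T.sign (T.comp p)) (T.sign (T.comp q))
    else 0
  else 0

/-- The matrix entry, from `S` to `T`, of the differential: the sum over the edges of the cube, an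
edge at `c` with the sign `(-1)` to the number of `1`-smoothed crossings before `c`. -/
noncomputable def diffCoeff (S T : D.Gen) : ℤ :=
  ∑ c : D.Crossing,
    if c ∉ S.state ∧ T.state = insert c S.state then
      (-1) ^ (S.state.filter fun c' => c'.1 < c.1).card * saddleCoeff c S T
    else 0

/-- The standard basis in homological degree `k` and quantum degree `q`. -/
abbrev BiGen (o : D.Orientation) (k q : ℤ) : Type :=
  {S : D.Gen // S.hdeg o = k ∧ S.qdeg o = q}

noncomputable instance fintypeBiGen (o : D.Orientation) (k q : ℤ) : Fintype (BiGen o k q) :=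
  Fintype.ofFinite _

/-- The Khovanov cochain space over `K` in bidegree `(k, q)`: coordinate vectors with respect to
the (finite) standard basis. -/
abbrev Chain (K : Type*) [Field K] (o : D.Orientation) (k q : ℤ) : Type _ :=
  BiGen o k q → K

/-- The part of the differential from bidegree `(k, q)` to bidegree `(k', q)`
(it vanishes unless `k' = k + 1`), given by its matrix. -/
noncomputable def diff (K : Type*) [Field K] (o : D.Orientation) (k k' q : ℤ) :
    Chain K o k q →ₗ[K] Chain K o k' q :=
  Matrix.mulVecLin (Matrix.of fun (T : BiGen o k' q) (S : BiGen o k q) =>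
    ((diffCoeff S.1 T.1 : ℤ) : K))

/-- Khovanov homology `H^{k,q}` of an oriented tangle diagram over the field `K`: the kernel of the
differential leaving bidegree `(k, q)` modulo the image of the one arriving there. -/
abbrev KhovanovHomology (K : Type*) [Field K] (o : D.Orientation) (k q : ℤ) : Type _ :=
  LinearMap.ker (diff K o k (k + 1) q) ⧸
    (LinearMap.range (diff K o (k - 1) k q)).submoduleOf (LinearMap.ker (diff K o k (k + 1) q))

end TangleDiagram

end KhTangle

/-!
The differential of the Khovanov complex of a simple tangle without circles vanishes, because no
smoothing has a circle.

Suppose that some smoothing has a circle `C`, and count, modulo two, the points of `C` to the left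
of a gap in a level line. A path that avoids the tangle diagram avoids every smoothing of it, so it
preserves this parity. The parity is zero at the boundary of the disc: `C` does not meet the bottom
and top sides, and it meets every level line in an even number of points.
As both sides of every point of the tangle can be connected to the boundary, the parity
is zero everywhere; but it differs on the two sides of a point of `C`
(`isArc_of_reachesBoundary`). This replaces the Jordan curve theorem.

A smoothing without circles has half as many components as the tangle has end points
(`two_mul_card_comp`): every arc has an even number of end points by the same parity count, which
bounds the number of components above, and the Euler characteristic bounds it below. So all
smoothings have the same number `N` of arcs as the tangle. A saddle then cannot split a
component, which would increase the number of components (`compOf_botLeft_eq_topRight`), and the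
multiplication vanishes on `W ⊗ W`, so every saddle acts by zero (`saddleCoeff_eq_zero`).

Hence the homology is the cochain space, with one generator for each set of crossings. A set with
`r` elements has bidegree `(r - n₋, r + n₊ - 2 n₋ - N)`, and these are the monomials of the
expansion of the product (`monomial_mul_pow_mul_pow`).
-/

namespace KhTangle

/-! ### Counting strands to the left of a gap, modulo two -/

namespace Layer

/-- The parities left of two joined gaps agree at a cup, with `x` on its lower and `y` on its upper
level. Exchanging the levels gives the case of a cap. -/
theorem sum_range_cup (x y : ℕ → ZMod 2) (i : ℕ) (hlt : ∀ a < i, y a = x a)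
    (hge : ∀ a, i ≤ a → y (a + 2) = x a) (hi : y i = y (i + 1)) {g h : ℕ}
    (hgh : (g ≤ i ∧ h = g) ∨ (i ≤ g ∧ h = g + 2)) :
    ∑ j ∈ Finset.range g, x j = ∑ j ∈ Finset.range h, y j := by
  have low : ∀ g ≤ i, ∑ j ∈ Finset.range g, x j = ∑ j ∈ Finset.range g, y j := fun g hg =>
    Finset.sum_congr rfl fun j hj => (hlt j ((Finset.mem_range.1 hj).trans_le hg)).symm
  rcases hgh with ⟨hg, rfl⟩ | ⟨hg, rfl⟩
  · exact low _ hg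
  · induction g, hg using Nat.le_induction with
    | base =>
      rw [Finset.sum_range_succ, Finset.sum_range_succ, ← hi, add_assoc, CharTwo.add_self_eq_zero,
        add_zero, low i le_rfl]
    | succ n hn ih => rw [Finset.sum_range_succ, ih, Finset.sum_range_succ _ (n + 2), hge n hn]

theorem sum_range_cross (x y : ℕ → ZMod 2) (i : ℕ) (hne : ∀ a, a ≠ i → a ≠ i + 1 → y a = x a)
    (hi : x i + x (i + 1) = y i + y (i + 1)) {g : ℕ} (hg : g ≠ i + 1) :
    ∑ j ∈ Finset.range g, x j = ∑ j ∈ Finset.range g, y j := by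
  have low : ∀ g ≤ i, ∑ j ∈ Finset.range g, x j = ∑ j ∈ Finset.range g, y j := fun g hg =>
    Finset.sum_congr rfl fun j hj => by
      have := Finset.mem_range.1 hj
      exact (hne j (by omega) (by omega)).symm
  rcases le_or_gt g i with h | h
  · exact low g h
  · have h2 : i + 2 ≤ g := by omega
    clear hg h
    induction g, h2 using Nat.le_induction with
    | base =>
      simp only [Finset.sum_range_succ, add_assoc]
      rw [hi, low i le_rfl]
    | succ n hn ih =>
      rw [Finset.sum_range_succ, ih, Finset.sum_range_succ _ n, hne n (by omega) (by omega)]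

/-- Suppose that `x` and `y` assign elements of `ZMod 2` to the strands at the lower and at the
upper level of a layer, constantly along the strands inside the layer (and zero beyond the
last strand).  Then the sums over the strands left of two gaps agree if a path joins the gaps. -/
theorem sum_range_eq_of_gapThrough (ℓ : Layer) (m : Local) {w w' : ℕ} (hf : ℓ.Fits w w')
    (x y : ℕ → ZMod 2) (hx : ∀ a, w ≤ a → x a = 0) (hy : ∀ b, w' ≤ b → y b = 0)
    (ht : ∀ a b, a < w → b < w' → ℓ.Through m a b → x a = y b)
    (hca : ∀ a b, a < w → b < w → ℓ.Capped m a b → x a = x b)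
    (hcu : ∀ a b, a < w' → b < w' → ℓ.Cupped m a b → y a = y b)
    {g h : ℕ} (hgh : ℓ.GapThrough g h) :
    ∑ j ∈ Finset.range g, x j = ∑ j ∈ Finset.range h, y j := by
  cases ℓ with
  | cup i =>
    obtain ⟨h1, rfl⟩ := hf
    refine sum_range_cup x y i (fun a ha => ?_) (fun a ha => ?_)
      (hcu _ _ (by omega) (by omega) ⟨rfl, rfl⟩) hgh
    · exact (ht a a (by omega) (by omega) (by simp [Through, ha])).symm
    · rcases lt_or_ge a w with hw | hw
      · exact (ht a (a + 2) (by omega) (by omega) (by simp [Through, ha])).symm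
      · rw [hx a hw, hy _ (by omega)]
  | cap i =>
    obtain ⟨h1, rfl⟩ := hf
    refine (sum_range_cup y x i (fun a ha => ?_) (fun a ha => ?_)
      (hca _ _ (by omega) (by omega) ⟨rfl, rfl⟩) hgh).symm
    · exact ht a a (by omega) (by omega) (by simp [Through, ha])
    · rcases lt_or_ge a w' with hw | hw
      · exact ht (a + 2) a (by omega) (by omega) (by simp [Through, ha])
      · rw [hy a hw, hx _ (by omega)]
  | cross i o =>
    obtain ⟨h1, rfl⟩ := hf
    obtain ⟨h2, rfl⟩ := hgh
    refine sum_range_cross x y i (fun a ha hb => ?_) ?_ h2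
    · rcases lt_or_ge a w' with hw | hw
      · refine (ht a a hw hw ?_).symm
        cases m
        · exact (Equiv.swap_apply_of_ne_of_ne ha hb).symm
        · rfl
        · exact ⟨rfl, ha, hb⟩
      · rw [hx a hw, hy a hw]
    · cases m
      · rw [ht i (i + 1) (by omega) (by omega) (Equiv.swap_apply_left _ _).symm,
          ht (i + 1) i (by omega) (by omega) (Equiv.swap_apply_right _ _).symm, add_comm]
      · rw [ht i i (by omega) (by omega) rfl, ht (i + 1) (i + 1) (by omega) (by omega) rfl]
      · rw [hca i (i + 1) (by omega) (by omega) ⟨rfl, rfl⟩,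
          hcu i (i + 1) (by omega) (by omega) ⟨rfl, rfl⟩, CharTwo.add_self_eq_zero,
          CharTwo.add_self_eq_zero]

theorem gapThrough_last {ℓ : Layer} {w w' : ℕ} (hf : ℓ.Fits w w') : ℓ.GapThrough w w' := by
  cases ℓ <;> simp only [Fits, GapThrough] at * <;> omega

/-- A layer between levels with `w` and `w'` strands holds `(w + w') / 2` pieces of strands. -/
theorem exists_edges (ℓ : Layer) (m : Local) {w w' : ℕ} (hf : ℓ.Fits w w') :
    ∃ (n : ℕ) (e : Fin n → (Fin w ⊕ Fin w') × (Fin w ⊕ Fin w')), 2 * n = w + w' ∧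
      (∀ (a : Fin w) (b : Fin w'), ℓ.Through m a b → ∃ j, e j = (.inl a, .inr b)) ∧
      (∀ a b : Fin w, ℓ.Capped m a b → ∃ j, e j = (.inl a, .inl b)) ∧
      (∀ a b : Fin w', ℓ.Cupped m a b → ∃ j, e j = (.inr a, .inr b)) := by
  suffices ∃ (J : Type) (_ : Fintype J) (e : J → (Fin w ⊕ Fin w') × (Fin w ⊕ Fin w')),
      2 * Fintype.card J = w + w' ∧
      (∀ (a : Fin w) (b : Fin w'), ℓ.Through m a b → ∃ j, e j = (.inl a, .inr b)) ∧
      (∀ a b : Fin w, ℓ.Capped m a b → ∃ j, e j = (.inl a, .inl b)) ∧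
      (∀ a b : Fin w', ℓ.Cupped m a b → ∃ j, e j = (.inr a, .inr b)) by
    obtain ⟨J, _, e, h0, h1, h2, h3⟩ := this
    let φ := Fintype.equivFin J
    refine ⟨_, e ∘ φ.symm, h0, fun a b h => ?_, fun a b h => ?_, fun a b h => ?_⟩
    · obtain ⟨j, hj⟩ := h1 a b h
      exact ⟨φ j, by simp [hj]⟩
    · obtain ⟨j, hj⟩ := h2 a b h
      exact ⟨φ j, by simp [hj]⟩
    · obtain ⟨j, hj⟩ := h3 a b h
      exact ⟨φ j, by simp [hj]⟩
  cases ℓ with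
  | cup i =>
    obtain ⟨h1, rfl⟩ := hf
    refine ⟨Option (Fin w), inferInstance, fun j => j.elim
      (.inr ⟨i, by omega⟩, .inr ⟨i + 1, by omega⟩)
      fun a => (.inl a, .inr ⟨if a.1 < i then a else a + 2, by split <;> omega⟩), ?_, ?_, ?_, ?_⟩
    · simp; ring
    · intro a b h
      exact ⟨some a, by
        simp only [Option.elim_some, Prod.mk.injEq, true_and, Sum.inr.injEq]
        exact Fin.ext h.symm⟩
    · intro a b h
      exact h.elim
    · intro a b h
      exact ⟨none, by simp [Fin.ext_iff, h.1, h.2]⟩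
  | cap i =>
    obtain ⟨h1, rfl⟩ := hf
    refine ⟨Option (Fin w'), inferInstance, fun j => j.elim
      (.inl ⟨i, by omega⟩, .inl ⟨i + 1, by omega⟩)
      fun b => (.inl ⟨if b.1 < i then b else b + 2, by split <;> omega⟩, .inr b), ?_, ?_, ?_, ?_⟩
    · simp; ring
    · intro a b h
      exact ⟨some b, by
        simp only [Option.elim_some, Prod.mk.injEq, and_true, Sum.inl.injEq]
        exact Fin.ext h.symm⟩
    · intro a b h
      exact ⟨none, by simp [Fin.ext_iff, h.1, h.2]⟩
    · intro a b h
      exact h.elim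
  | cross i o =>
    obtain ⟨h1, rfl⟩ := hf
    cases m with
    | pass =>
      have hs : ∀ a, a < w' → Equiv.swap i (i + 1) a < w' := fun a ha => by
        rw [Equiv.swap_apply_def]; split_ifs <;> omega
      refine ⟨Fin w', inferInstance, fun a => (.inl a, .inr ⟨_, hs a a.2⟩), ?_, ?_, ?_, ?_⟩
      · simp; ring
      · intro a b h
        exact ⟨a, by
          simp only [Prod.mk.injEq, true_and, Sum.inr.injEq]
          exact Fin.ext h.symm⟩
      · intro a b h
        exact h.elim
      · intro a b h
        exact h.elim
    | vert =>
      refine ⟨Fin w', inferInstance, fun a => (.inl a, .inr a), ?_, ?_, ?_, ?_⟩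
      · simp; ring
      · intro a b h
        exact ⟨a, by rw [Fin.ext (h : b.1 = a.1)]⟩
      · intro a b h
        exact h.elim
      · intro a b h
        exact h.elim
    | horiz =>
      refine ⟨Fin w', inferInstance, fun a =>
        if a.1 = i then (.inl ⟨i, by omega⟩, .inl ⟨i + 1, h1⟩)
        else if a.1 = i + 1 then (.inr ⟨i, by omega⟩, .inr ⟨i + 1, h1⟩)
        else (.inl a, .inr a), ?_, ?_, ?_, ?_⟩
      · simp; ring
      · rintro a b ⟨h, h2, h3⟩
        exact ⟨a, by simp [h2, h3, Fin.ext_iff, h]⟩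
      · intro a b h
        exact ⟨⟨i, by omega⟩, by simp [Fin.ext_iff, h.1, h.2]⟩
      · intro a b h
        exact ⟨⟨i + 1, by omega⟩, by simp [Fin.ext_iff, h.1, h.2]⟩

end Layer

namespace TangleDiagram

variable {D : TangleDiagram}

/-! ### Components of a smoothed diagram -/

instance finiteComp (R : Fin D.length → Local) : Finite (D.Comp R) :=
  Finite.of_surjective _ Quot.mk_surjective

/-- Two points are neighbours on a strand, inside one layer. -/
def Neighbour (R : Fin D.length → Local) (p q : D.Point) : Prop :=
  ∃ k : Fin D.length,
    (p.1 = k.castSucc ∧ q.1 = k.succ ∧ (D.layer k).Through (R k) p.2 q.2) ∨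
    (p.1 = k.castSucc ∧ q.1 = k.castSucc ∧ (D.layer k).Capped (R k) p.2 q.2) ∨
    (p.1 = k.succ ∧ q.1 = k.succ ∧ (D.layer k).Cupped (R k) p.2 q.2)

/-- The component of the smoothed diagram that passes through a point. -/
abbrev compOf (R : Fin D.length → Local) (p : D.Point) : D.Comp R :=
  (D.graph R).connectedComponentMk p

theorem Neighbour.compOf_eq {R : Fin D.length → Local} {p q : D.Point} (h : Neighbour R p q) :
    compOf R p = compOf R q := by
  by_cases hpq : p = q
  · rw [hpq]
  · exact SimpleGraph.ConnectedComponent.connectedComponentMk_eq_of_adj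
      ((SimpleGraph.fromRel_adj _ _ _).2 ⟨hpq, Or.inl h⟩)

/-- A function on points that is constant along strands takes one value on each component. -/
theorem eq_of_compOf_eq {α : Type*} {R : Fin D.length → Local} (f : D.Point → α)
    (hf : ∀ p q, Neighbour R p q → f p = f q) {p q : D.Point} (h : compOf R p = compOf R q) :
    f p = f q := by
  obtain ⟨w⟩ := SimpleGraph.ConnectedComponent.exact h
  induction w with
  | nil => rfl
  | cons hadj _ ih =>
    rw [← ih (SimpleGraph.ConnectedComponent.sound ⟨_⟩)]
    · rcases ((SimpleGraph.fromRel_adj _ _ _).1 hadj).2 with h | h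
      · exact hf _ _ h
      · exact (hf _ _ h).symm
    · assumption

open Classical in
/-- The indicator of a component `X` on the strands at level `k`, with values in `ZMod 2` and
zero beyond the last strand. -/
noncomputable def levelIndicator {R : Fin D.length → Local} (X : D.Comp R)
    (k : Fin (D.length + 1)) (j : ℕ) : ZMod 2 :=
  if h : j < D.width k then (if compOf R ⟨k, ⟨j, h⟩⟩ = X then 1 else 0) else 0

/-- The parity of the number of points of a component to the left of a gap. -/
noncomputable def leftParity {R : Fin D.length → Local} (X : D.Comp R)
    (k : Fin (D.length + 1)) (g : ℕ) : ZMod 2 :=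
  ∑ j ∈ Finset.range g, levelIndicator X k j

theorem leftParity_eq_of_gapThrough {R : Fin D.length → Local} (X : D.Comp R) (k : Fin D.length)
    {g h : ℕ} (hgh : (D.layer k).GapThrough g h) :
    leftParity X k.castSucc g = leftParity X k.succ h := by
  have key : ∀ {k k' : Fin (D.length + 1)} {a b : ℕ} (ha : a < D.width k) (hb : b < D.width k'),
      Neighbour R ⟨k, ⟨a, ha⟩⟩ ⟨k', ⟨b, hb⟩⟩ → levelIndicator X k a = levelIndicator X k' b := by
    intro k k' a b ha hb h
    rw [levelIndicator, levelIndicator, dif_pos ha, dif_pos hb, h.compOf_eq]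
  refine Layer.sum_range_eq_of_gapThrough (D.layer k) (R k) (D.fits k) _ _ ?_ ?_ ?_ ?_ ?_ hgh
  · intro a ha
    simp [levelIndicator, ha.not_gt]
  · intro a ha
    simp [levelIndicator, ha.not_gt]
  · intro a b ha hb h
    exact key ha hb ⟨k, Or.inl ⟨rfl, rfl, h⟩⟩
  · intro a b ha hb h
    exact key ha hb ⟨k, Or.inr (Or.inl ⟨rfl, rfl, h⟩)⟩
  · intro a b ha hb h
    exact key ha hb ⟨k, Or.inr (Or.inr ⟨rfl, rfl, h⟩)⟩

/-- All levels meet a component in the same number of points modulo two. -/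
theorem leftParity_width {R : Fin D.length → Local} (X : D.Comp R) (k : Fin (D.length + 1)) :
    leftParity X k (D.width k) = leftParity X 0 (D.width 0) := by
  induction k using Fin.induction with
  | zero => rfl
  | succ k ih => rw [← ih, leftParity_eq_of_gapThrough X k (Layer.gapThrough_last (D.fits k))]

theorem isArc_of_compOf_eq {R : Fin D.length → Local} {X : D.Comp R} {p : D.Point}
    (hp : D.IsEndpoint p) (h : compOf R p = X) : D.IsArc X := ⟨p, hp, h⟩

/-- No point on the boundary of the disc lies on a circle, so a circle has an even number of points
to the left of each gap on the boundary. -/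
theorem leftParity_eq_zero_of_onBoundary {R : Fin D.length → Local} {X : D.Comp R}
    (hX : ¬ D.IsArc X) {g : D.Gap} (hg : g.OnBoundary) : leftParity X g.1 g.2 = 0 := by
  have hend : ∀ k : Fin (D.length + 1), (k = 0 ∨ k = Fin.last _) → ∀ n, leftParity X k n = 0 := by
    intro k hk n
    refine Finset.sum_eq_zero fun j _ => ?_
    unfold levelIndicator
    split_ifs with h1 h2
    · exact absurd (isArc_of_compOf_eq (p := ⟨k, ⟨j, h1⟩⟩) hk h2) hX
    · rfl
    · rfl
  rcases hg with h | h | h | h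
  · exact hend _ (Or.inl h) _
  · exact hend _ (Or.inr h) _
  · simp [leftParity, h]
  · rw [h, leftParity_width]
    exact hend _ (Or.inl rfl) _

theorem leftParity_eq_zero_of_reachesBoundary {R : Fin D.length → Local} {X : D.Comp R}
    (hX : ¬ D.IsArc X) {g : D.Gap} (hg : g.ReachesBoundary) : leftParity X g.1 g.2 = 0 := by
  obtain ⟨h, hb, ⟨w⟩⟩ := hg
  induction w with
  | nil => exact leftParity_eq_zero_of_onBoundary hX hb
  | cons hadj _ ih =>
    have key : ∀ u v : D.Gap, (∃ k : Fin D.length, u.1 = k.castSucc ∧ v.1 = k.succ ∧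
        (D.layer k).GapThrough u.2 v.2) → leftParity X u.1 u.2 = leftParity X v.1 v.2 := by
      rintro ⟨u1, u2⟩ ⟨v1, v2⟩ ⟨k, rfl, rfl, h3⟩
      exact leftParity_eq_of_gapThrough X k h3
    rw [← ih hb]
    rcases ((SimpleGraph.fromRel_adj _ _ _).1 hadj).2 with h | h
    · exact key _ _ h
    · exact (key _ _ h).symm

/-- If both sides of every point can be connected to the boundary of the disc, then no smoothing
has a circle: the number of points of a circle to the left of a gap is odd on one side
of each of its points, but a path to the boundary preserves its parity. -/
theorem isArc_of_reachesBoundary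
    (h : ∀ p, (D.leftGap p).ReachesBoundary ∧ (D.rightGap p).ReachesBoundary)
    {R : Fin D.length → Local} (X : D.Comp R) : D.IsArc X := by
  by_contra hX
  obtain ⟨p, rfl⟩ : ∃ p, compOf R p = X := Quot.exists_rep X
  have h1 := leftParity_eq_zero_of_reachesBoundary hX (h p).1
  have h2 := leftParity_eq_zero_of_reachesBoundary hX (h p).2
  have h3 : levelIndicator (compOf R p) p.1 p.2 = 1 := by
    simp [levelIndicator]
  simp only [leftParity, leftGap, rightGap, Fin.val_succ, Fin.val_castSucc] at h1 h2
  rw [Finset.sum_range_succ, h1, h3] at h2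
  exact absurd h2 (by decide)

/-! ### The number of arcs -/

open Classical in
/-- The number of points of a component at a level. -/
noncomputable def levelCount {R : Fin D.length → Local} (X : D.Comp R)
    (k : Fin (D.length + 1)) : ℕ :=
  (Finset.univ.filter fun i : Fin (D.width k) => compOf R ⟨k, i⟩ = X).card

theorem natCast_levelCount {R : Fin D.length → Local} (X : D.Comp R) (k : Fin (D.length + 1)) :
    (levelCount X k : ZMod 2) = leftParity X k (D.width k) := by
  classical
  rw [leftParity, Finset.sum_range, levelCount, Finset.natCast_card_filter]
  refine Finset.sum_congr rfl fun i _ => ?_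
  simp [levelIndicator]

theorem sum_levelCount {R : Fin D.length → Local} [Fintype (D.Comp R)] (k : Fin (D.length + 1)) :
    ∑ X : D.Comp R, levelCount X k = D.width k := by
  classical
  have := Finset.card_eq_sum_card_fiberwise (s := (Finset.univ : Finset (Fin (D.width k))))
    (t := Finset.univ) (f := fun i => compOf R ⟨k, i⟩) (fun _ _ => Finset.mem_univ _)
  simpa [levelCount] using this.symm

/-- Every arc has at least two end points. -/
theorem two_le_levelCount_add {R : Fin D.length → Local} {X : D.Comp R} (hX : D.IsArc X) :
    2 ≤ levelCount X 0 + levelCount X (Fin.last _) := by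
  classical
  have hpar : ((levelCount X 0 + levelCount X (Fin.last _) : ℕ) : ZMod 2) = 0 := by
    rw [Nat.cast_add, natCast_levelCount, natCast_levelCount, leftParity_width X (Fin.last _),
      CharTwo.add_self_eq_zero]
  rw [ZMod.natCast_eq_zero_iff] at hpar
  have hpos : 0 < levelCount X 0 + levelCount X (Fin.last _) := by
    obtain ⟨⟨k, i⟩, hp, h⟩ := hX
    have : 0 < levelCount X k := Finset.card_pos.2 ⟨i, by simpa using h⟩
    rcases hp with hp | hp <;> simp only at hp <;> subst hp <;> omega
  omega

theorem two_mul_card_comp_le {R : Fin D.length → Local} (h : ∀ X : D.Comp R, D.IsArc X) :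
    2 * Nat.card (D.Comp R) ≤ D.width 0 + D.width (Fin.last _) := by
  have := Fintype.ofFinite (D.Comp R)
  rw [← sum_levelCount (R := R) 0, ← sum_levelCount (R := R) (Fin.last _),
    ← Finset.sum_add_distrib, Nat.card_eq_fintype_card, mul_comm, ← smul_eq_mul]
  exact Finset.card_nsmul_le_sum _ _ _ fun X _ => two_le_levelCount_add (h X)

/-- A smoothed diagram has at least half as many components as end points.  This is the Euler
characteristic of the diagram: there are as many pieces of strands as points, if end points
are counted half, so rank-nullity for the coboundary map from functions on the
points to functions on the pieces of strands bounds its kernel below. -/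
theorem le_two_mul_card_comp (R : Fin D.length → Local) :
    D.width 0 + D.width (Fin.last _) ≤ 2 * Nat.card (D.Comp R) := by
  choose n e hn ht hca hcu using fun k : Fin D.length =>
    (D.layer k).exists_edges (R k) (D.fits k)
  let pt (k : Fin D.length) : Fin (D.width k.castSucc) ⊕ Fin (D.width k.succ) → D.Point :=
    Sum.elim (fun a => ⟨k.castSucc, a⟩) fun b => ⟨k.succ, b⟩
  let d : (D.Point → ℚ) →ₗ[ℚ] ((Σ k, Fin (n k)) → ℚ) :=
    { toFun := fun f j => f (pt j.1 (e j.1 j.2).1) - f (pt j.1 (e j.1 j.2).2)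
      map_add' := fun f g => by ext j; simp only [Pi.add_apply]; ring
      map_smul' := fun c f => by
        ext j; simp only [Pi.smul_apply, smul_eq_mul, RingHom.id_apply]; ring }
  have hker : ∀ f ∈ LinearMap.ker d, ∀ p q, Neighbour R p q → f p = f q := by
    intro f hf p q hpq
    have hd : ∀ k (j : Fin (n k)) u v, e k j = (u, v) → f (pt k u) = f (pt k v) := by
      intro k j u v huv
      have := congrFun (LinearMap.mem_ker.1 hf) ⟨k, j⟩
      simp only [d, LinearMap.coe_mk, AddHom.coe_mk, huv, Pi.zero_apply] at this
      exact sub_eq_zero.1 this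
    obtain ⟨p1, p2⟩ := p
    obtain ⟨q1, q2⟩ := q
    obtain ⟨k, ⟨rfl, rfl, h⟩ | ⟨rfl, rfl, h⟩ | ⟨rfl, rfl, h⟩⟩ := hpq
    · obtain ⟨j, hj⟩ := ht k p2 q2 h
      exact hd k j _ _ hj
    · obtain ⟨j, hj⟩ := hca k p2 q2 h
      exact hd k j _ _ hj
    · obtain ⟨j, hj⟩ := hcu k p2 q2 h
      exact hd k j _ _ hj
  have := Fintype.ofFinite (D.Comp R)
  have hle : Module.finrank ℚ (LinearMap.ker d) ≤ Nat.card (D.Comp R) := by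
    let r : LinearMap.ker d →ₗ[ℚ] (D.Comp R → ℚ) :=
      { toFun := fun f X => f.1 X.out
        map_add' := fun f g => rfl
        map_smul' := fun c f => rfl }
    have hr : Function.Injective r := by
      intro f g hfg
      have hout (f : LinearMap.ker d) (p : D.Point) : f.1 p = r f (compOf R p) :=
        eq_of_compOf_eq f.1 (hker f.1 f.2) (Quot.out_eq (compOf R p)).symm
      exact Subtype.ext (funext fun p => by rw [hout f, hout g, hfg])
    simpa [Nat.card_eq_fintype_card] using LinearMap.finrank_le_finrank_of_injective hr
  have hrn := d.finrank_range_add_finrank_ker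
  have hrange := (LinearMap.range d).finrank_le
  simp only [Module.finrank_pi, Fintype.card_sigma, Fintype.card_fin] at hrn hrange
  have h2 : 2 * ∑ k, n k = 
      ∑ k : Fin D.length, D.width k.castSucc + ∑ k : Fin D.length, D.width k.succ := by
    rw [Finset.mul_sum, ← Finset.sum_add_distrib]
    exact Finset.sum_congr rfl fun k _ => hn k
  have h3 := Fin.sum_univ_succ D.width
  have h4 := Fin.sum_univ_castSucc D.width
  omega

/-- The number of arcs is half the number of end points, for every smoothing without circles. -/
theorem two_mul_card_comp {R : Fin D.length → Local} (h : ∀ X : D.Comp R, D.IsArc X) :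
    2 * Nat.card (D.Comp R) = D.width 0 + D.width (Fin.last _) :=
  (two_mul_card_comp_le h).antisymm (le_two_mul_card_comp R)

/-! ### Saddles -/

theorem Crossing.layer_eq (c : D.Crossing) :
    D.layer c.1 = .cross (D.layer c.1).pos (D.layer c.1).slashOver := by
  have hc := c.2
  revert hc
  cases D.layer c.1 <;> simp [Layer.isCross, Layer.pos, Layer.slashOver]

/-- If the two local strands of a smoothing at the crossing `c` lie on one component, then the
strands of the other smoothing at `c` join no further components. -/
theorem compOf_eq_of_neighbour {R R' : Fin D.length → Local} (c : D.Crossing)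
    (hoff : ∀ k, k ≠ c.1 → R k = R' k) (hR : R c.1 ≠ .pass) (hR' : R' c.1 ≠ .pass)
    (hc : compOf R (D.botLeft c) = compOf R (D.topRight c)) {p q : D.Point}
    (hpq : Neighbour R' p q) : compOf R p = compOf R q := by
  obtain ⟨k, hk⟩ := hpq
  by_cases hkc : k = c.1
  swap
  · rw [← hoff k hkc] at hk
    exact Neighbour.compOf_eq ⟨k, hk⟩
  subst hkc
  obtain ⟨i, hi⟩ : ∃ i, (D.layer c.1).pos = i := ⟨_, rfl⟩
  have hl := c.layer_eq
  have hw := D.fits_cross c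
  rw [hi] at hl hw
  have hbl : D.botLeft c = ⟨c.1.castSucc, ⟨i, by omega⟩⟩ := by simp [botLeft, hi]
  have htr : D.topRight c = ⟨c.1.succ, ⟨i + 1, by omega⟩⟩ := by simp [topRight, hi]
  rw [hbl, htr] at hc
  -- All four corners of `c` lie on one component.
  have corners : compOf R ⟨c.1.castSucc, ⟨i + 1, by omega⟩⟩ =
        compOf R ⟨c.1.castSucc, ⟨i, by omega⟩⟩ ∧
      compOf R ⟨c.1.succ, ⟨i, by omega⟩⟩ = compOf R ⟨c.1.castSucc, ⟨i, by omega⟩⟩ := by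
    rcases hRc : R c.1 with _ | _ | _
    · exact absurd hRc hR
    · refine ⟨(Neighbour.compOf_eq ⟨c.1, Or.inl ⟨rfl, rfl, ?_⟩⟩).trans hc.symm,
        (Neighbour.compOf_eq ⟨c.1, Or.inl ⟨rfl, rfl, ?_⟩⟩).symm⟩ <;>
      · rw [hRc, hl]; rfl
    · refine ⟨(Neighbour.compOf_eq ⟨c.1, Or.inr (Or.inl ⟨rfl, rfl, ?_⟩)⟩).symm,
        (Neighbour.compOf_eq ⟨c.1, Or.inr (Or.inr ⟨rfl, rfl, ?_⟩)⟩).trans hc.symm⟩ <;>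
      · rw [hRc, hl]; exact ⟨rfl, rfl⟩
  have bot : ∀ {a : ℕ} (ha : a < D.width c.1.castSucc), a = i ∨ a = i + 1 →
      compOf R ⟨c.1.castSucc, ⟨a, ha⟩⟩ = compOf R ⟨c.1.castSucc, ⟨i, by omega⟩⟩ := by
    rintro a ha (rfl | rfl)
    · rfl
    · exact corners.1
  have top : ∀ {a : ℕ} (ha : a < D.width c.1.succ), a = i ∨ a = i + 1 →
      compOf R ⟨c.1.succ, ⟨a, ha⟩⟩ = compOf R ⟨c.1.castSucc, ⟨i, by omega⟩⟩ := by
    rintro a ha (rfl | rfl)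
    · exact corners.2
    · exact hc.symm
  have through : ∀ (a : ℕ) (ha : a < D.width c.1.castSucc) (hb : a < D.width c.1.succ),
      compOf R ⟨c.1.castSucc, ⟨a, ha⟩⟩ = compOf R ⟨c.1.succ, ⟨a, hb⟩⟩ := by
    intro a ha hb
    by_cases h : a = i ∨ a = i + 1
    · rw [bot ha h, top hb h]
    · push Not at h
      refine Neighbour.compOf_eq ⟨c.1, Or.inl ⟨rfl, rfl, ?_⟩⟩
      rw [hl]
      rcases hRc : R c.1 with _ | _ | _
      · exact absurd hRc hR
      · rfl
      · exact ⟨rfl, h⟩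
  obtain ⟨p1, a, ha⟩ := p
  obtain ⟨q1, b, hb⟩ := q
  rw [hl] at hk
  rcases hRc : R' c.1 with _ | _ | _ <;> rw [hRc] at hk
  · exact absurd hRc hR'
  · obtain ⟨rfl, rfl, h⟩ | ⟨_, _, h⟩ | ⟨_, _, h⟩ := hk
    · obtain rfl : b = a := h
      exact through b ha hb
    · exact h.elim
    · exact h.elim
  · obtain ⟨rfl, rfl, h⟩ | ⟨rfl, rfl, h⟩ | ⟨rfl, rfl, h⟩ := hk
    · obtain rfl : b = a := h.1
      exact through b ha hb
    · rw [bot ha (Or.inl h.1), bot hb (Or.inr h.2)]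
    · rw [top ha (Or.inl h.1), top hb (Or.inr h.2)]

/-- If a saddle at `c` starts at one component and does not change the number of components, then
it ends at one component: a split would increase the number. -/
theorem compOf_botLeft_eq_topRight {R R' : Fin D.length → Local} (c : D.Crossing)
    (hoff : ∀ k, k ≠ c.1 → R k = R' k) (hR : R c.1 ≠ .pass) (hR' : R' c.1 ≠ .pass)
    (hcard : Nat.card (D.Comp R) = Nat.card (D.Comp R'))
    (hc : compOf R (D.botLeft c) = compOf R (D.topRight c)) :
    compOf R' (D.botLeft c) = compOf R' (D.topRight c) := by
  let f : D.Comp R' → D.Comp R := fun X => compOf R X.out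
  have hf : ∀ p, f (compOf R' p) = compOf R p := fun p =>
    eq_of_compOf_eq (R := R') (compOf R)
      (fun _ _ h => compOf_eq_of_neighbour c hoff hR hR' hc h) (Quot.out_eq (compOf R' p))
  have hsurj : Function.Surjective f := by
    intro X
    obtain ⟨p, rfl⟩ : ∃ p, compOf R p = X := Quot.exists_rep X
    exact ⟨_, hf p⟩
  have hinj : Function.Injective f :=
    ((Nat.bijective_iff_surjective_and_card f).2 ⟨hsurj, hcard.symm⟩).1
  exact hinj (by rw [hf, hf, hc])

theorem resolution_ne_pass (s : D.State) (k : Fin D.length) : D.resolution s k ≠ .pass := by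
  unfold resolution
  split_ifs <;> simp

theorem resolution_insert {s : D.State} {c : D.Crossing} {k : Fin D.length} (hk : k ≠ c.1) :
    D.resolution (insert c s) k = D.resolution s k := by
  have : (∃ c' ∈ insert c s, c'.1 = k) ↔ ∃ c' ∈ s, c'.1 = k := by
    simp only [Finset.mem_insert, exists_eq_or_imp, hk.symm, false_or]
  simp only [resolution, this]

/-! ### The Khovanov complex when no smoothing has a circle -/

section NoCircles

variable (harc : ∀ (R : Fin D.length → Local) (X : D.Comp R), D.IsArc X)

include harc

theorem card_comp_eq (R R' : Fin D.length → Local) :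
    Nat.card (D.Comp R) = Nat.card (D.Comp R') := by
  have h1 := two_mul_card_comp (harc R)
  have h2 := two_mul_card_comp (harc R')
  omega

/-- A saddle between arcs only is zero: it does not split a component, and `W ⊗ W` is killed by
the multiplication. -/
theorem saddleCoeff_eq_zero {c : D.Crossing} {S T : D.Gen} (hT : T.state = insert c S.state) :
    saddleCoeff c S T = 0 := by
  have hsplit : S.comp (D.botLeft c) = S.comp (D.topRight c) →
      T.comp (D.botLeft c) = T.comp (D.topRight c) :=
    compOf_botLeft_eq_topRight c (fun k hk => by rw [hT, resolution_insert hk])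
      (resolution_ne_pass _ _) (resolution_ne_pass _ _) (card_comp_eq harc _ _)
  have hS : ∀ X, S.sign X = false := fun X => S.arc X (harc _ X)
  unfold saddleCoeff
  dsimp only
  split_ifs with h1 h2 h3
  · rw [hS, hS]
    rfl
  · exact absurd (hsplit h3.1) h3.2
  · rfl
  · rfl

theorem diffCoeff_eq_zero (S T : D.Gen) : diffCoeff S T = 0 := by
  refine Finset.sum_eq_zero fun c _ => ?_
  split_ifs with h
  · rw [saddleCoeff_eq_zero harc h.2, mul_zero]
  · rfl

theorem diff_eq_zero (K : Type*) [Field K] (o : D.Orientation) (k k' q : ℤ) :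
    diff K o k k' q = 0 := by
  have : (Matrix.of fun (T : BiGen o k' q) (S : BiGen o k q) =>
      ((diffCoeff S.1 T.1 : ℤ) : K)) = 0 := by
    ext T S
    simp [diffCoeff_eq_zero harc]
  rw [diff, this, Matrix.mulVecLin_zero]

/-- The homology is the cochain space, as the differential vanishes. -/
noncomputable def homologyEquivChain (K : Type*) [Field K] (o : D.Orientation) (k q : ℤ) :
    KhovanovHomology K o k q ≃ₗ[K] Chain K o k q :=
  (Submodule.quotEquivOfEqBot _ (by
      rw [diff_eq_zero harc K o (k - 1), LinearMap.range_zero, Submodule.submoduleOf,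
        Submodule.comap_bot, Submodule.ker_subtype])).trans
    (LinearEquiv.ofTop _ (by rw [diff_eq_zero harc, LinearMap.ker_zero]))

/-- The generators are the states: every component carries the sign of an arc. -/
def genEquivState : D.Gen ≃ D.State where
  toFun := Gen.state
  invFun s := ⟨s, fun _ => false, fun _ _ => rfl⟩
  left_inv := by
    rintro ⟨s, e, he⟩
    obtain rfl : e = fun _ => false := funext fun X => he X (harc _ X)
    rfl
  right_inv _ := rfl

/-- All generators have the same degree `θ`; for the diagram itself in place of the
smoothing this is minus the number of arcs of the tangle. -/
theorem theta_eq (R : Fin D.length → Local) (S : D.Gen) :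
    S.theta = -(Nat.card (D.Comp R) : ℤ) := by
  have hS : ∀ X, S.sign X = false := fun X => S.arc X (harc _ X)
  have h1 : Nat.card {X // S.sign X = true} = 0 := by
    have : IsEmpty {X // S.sign X = true} := ⟨fun X => by simpa [hS] using X.2⟩
    exact Nat.card_of_isEmpty
  have h2 : Nat.card {X // S.sign X = false} = Nat.card (D.Comp R) := by
    rw [card_comp_eq harc R (D.resolution S.state)]
    exact Nat.card_congr (Equiv.subtypeUnivEquiv hS)
  rw [Gen.theta, h1, h2, Nat.cast_zero, zero_sub]

end NoCircles

theorem Orientation.card_crossing (o : D.Orientation) :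
    Fintype.card D.Crossing = o.nPos + o.nNeg := by
  classical
  rw [nPos, nNeg, Nat.card_eq_fintype_card, Nat.card_eq_fintype_card, Fintype.card_subtype_compl]
  have := Fintype.card_subtype_le fun c => o.IsRightHanded c
  omega

theorem finrank_directSum_homology
    (harc : ∀ (R : Fin D.length → Local) (X : D.Comp R), D.IsArc X)
    (K : Type*) [Field K] (o : D.Orientation) :
    Module.finrank K (DirectSum (ℤ × ℤ) fun b => KhovanovHomology K o b.1 b.2) =
      2 ^ (o.nPos + o.nNeg) := by
  classical
  -- Every generator has exactly one bidegree.
  let e : D.Gen ≃ Σ b : ℤ × ℤ, BiGen o b.1 b.2 :=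
    { toFun := fun S => ⟨(S.hdeg o, S.qdeg o), S, rfl, rfl⟩
      invFun := fun x => x.2.1
      left_inv := fun _ => rfl
      right_inv := by
        rintro ⟨⟨k, q⟩, S, hk, hq⟩
        dsimp only at hk hq
        subst hk hq
        rfl }
  let β (b : ℤ × ℤ) : Module.Basis (BiGen o b.1 b.2) K (KhovanovHomology K o b.1 b.2) :=
    .ofEquivFun (homologyEquivChain harc K o b.1 b.2)
  let B : Module.Basis (Σ b : ℤ × ℤ, BiGen o b.1 b.2) K
      (DirectSum (ℤ × ℤ) fun b => KhovanovHomology K o b.1 b.2) := DFinsupp.basis β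
  rw [Module.finrank_eq_nat_card_basis B, Nat.card_congr (e.symm.trans (genEquivState harc)),
    Nat.card_eq_fintype_card, Fintype.card_finset, o.card_crossing]

theorem card_biGen (harc : ∀ (R : Fin D.length → Local) (X : D.Comp R), D.IsArc X)
    (R : Fin D.length → Local) (o : D.Orientation) (k q : ℤ) :
    Fintype.card (BiGen o k q) =
      (Finset.univ.filter fun s : D.State => (s.card : ℤ) - o.nNeg = k ∧
        s.card + o.nPos - 2 * o.nNeg - Nat.card (D.Comp R) = q).card := by
  rw [← Fintype.card_subtype]
  refine Fintype.card_congr ((genEquivState harc).subtypeEquiv fun S => ?_)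
  rw [Gen.qdeg, theta_eq harc R S, Gen.hdeg]
  change _ ↔ (S.state.card : ℤ) - _ = k ∧ (S.state.card : ℤ) + _ - _ - _ = q
  constructor <;> rintro ⟨h1, h2⟩ <;> constructor <;> linarith

/-- The product of the binomial powers is a monomial times a power of `(0, 0) + (1, 1)`, hence a
sum of monomials over all subsets of an index set with `p + n` elements. -/
theorem monomial_mul_pow_mul_pow (A : Type*) [CommRing A] (ι : Type*) [Fintype ι] (N p n : ℕ)
    (hι : Fintype.card ι = p + n) :
    (AddMonoidAlgebra.single (((N : ℤ) - p - n) • ((0 : ℤ), (-1 : ℤ))) (1 : A) *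
        (AddMonoidAlgebra.single ((0 : ℤ), (0 : ℤ)) (1 : A) +
          AddMonoidAlgebra.single ((1 : ℤ), (1 : ℤ)) (1 : A)) ^ p *
        (AddMonoidAlgebra.single ((-1 : ℤ), (-3 : ℤ)) (1 : A) +
          AddMonoidAlgebra.single ((0 : ℤ), (-2 : ℤ)) (1 : A)) ^ n) =
      ∑ s : Finset ι, AddMonoidAlgebra.single
        ((s.card : ℤ) - n, (s.card : ℤ) + p - 2 * n - N) (1 : A) := by
  have h1 : AddMonoidAlgebra.single ((-1 : ℤ), (-3 : ℤ)) (1 : A) +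
      AddMonoidAlgebra.single ((0 : ℤ), (-2 : ℤ)) (1 : A) =
      AddMonoidAlgebra.single ((-1 : ℤ), (-3 : ℤ)) (1 : A) *
        (AddMonoidAlgebra.single ((0 : ℤ), (0 : ℤ)) (1 : A) +
          AddMonoidAlgebra.single ((1 : ℤ), (1 : ℤ)) (1 : A)) := by
    simp [mul_add, AddMonoidAlgebra.single_mul_single]
  have h2 : (AddMonoidAlgebra.single ((0 : ℤ), (0 : ℤ)) (1 : A) +
        AddMonoidAlgebra.single ((1 : ℤ), (1 : ℤ)) (1 : A)) ^ (p + n) =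
      ∑ s : Finset ι, AddMonoidAlgebra.single ((s.card : ℤ), (s.card : ℤ)) (1 : A) := by
    rw [add_comm (AddMonoidAlgebra.single _ _), ← hι, ← Fintype.sum_pow_mul_eq_add_pow]
    simp [AddMonoidAlgebra.single_pow, AddMonoidAlgebra.single_mul_single]
  rw [h1, mul_pow, mul_assoc, mul_left_comm (_ ^ p), ← pow_add, h2, ← mul_assoc,
    AddMonoidAlgebra.single_pow, AddMonoidAlgebra.single_mul_single, Finset.mul_sum]
  refine Finset.sum_congr rfl fun s _ => ?_
  rw [AddMonoidAlgebra.single_mul_single]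
  congr 1
  · ext <;> simp <;> ring
  · simp

end TangleDiagram

end KhTangle

theorem theorem2p12 (K : Type*) [Field K] (D : KhTangle.TangleDiagram) (o : D.Orientation) (N : ℕ)
    (hN : D.ConsistsOfArcs N) (hD : D.IsSimple) :
    Module.finrank K
        (DirectSum (ℤ × ℤ) fun b => KhTangle.TangleDiagram.KhovanovHomology K o b.1 b.2) =
      2 ^ (o.nPos + o.nNeg) ∧
    ∀ (R : Type*) [CommRing R] (k q : ℤ),
      (Module.finrank K (KhTangle.TangleDiagram.KhovanovHomology K o k q) : R) =
        AddMonoidAlgebra.coeff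
          (AddMonoidAlgebra.single (((N : ℤ) - o.nPos - o.nNeg) • ((0 : ℤ), (-1 : ℤ))) (1 : R) *
            (AddMonoidAlgebra.single ((0 : ℤ), (0 : ℤ)) (1 : R) +
              AddMonoidAlgebra.single ((1 : ℤ), (1 : ℤ)) (1 : R)) ^ o.nPos *
            (AddMonoidAlgebra.single ((-1 : ℤ), (-3 : ℤ)) (1 : R) +
              AddMonoidAlgebra.single ((0 : ℤ), (-2 : ℤ)) (1 : R)) ^ o.nNeg)
          (k, q) := by
  -- Since all components are pure arcs, both sides of every point reach the boundary.
  have harc : ∀ (R : Fin D.length → KhTangle.Local) (X : D.Comp R), D.IsArc X := fun R X =>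
    KhTangle.TangleDiagram.isArc_of_reachesBoundary (fun p => hD _ (hN.1 _) p rfl) X
  refine ⟨KhTangle.TangleDiagram.finrank_directSum_homology harc K o, fun R _ k q => ?_⟩
  rw [(KhTangle.TangleDiagram.homologyEquivChain harc K o k q).finrank_eq, Module.finrank_pi,
    KhTangle.TangleDiagram.card_biGen harc (fun _ => KhTangle.Local.pass), hN.2,
    KhTangle.TangleDiagram.monomial_mul_pow_mul_pow R D.Crossing N _ _ o.card_crossing,
    AddMonoidAlgebra.coeff_sum, Finsupp.finsetSum_apply, Finset.natCast_card_filter]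
  refine Finset.sum_congr rfl fun s _ => ?_
  simp [Finsupp.single_apply, Prod.ext_iff]
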